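/- A \emph{fundamental} matrix is a symmetric real matrix $A=(a_{ij})$ with $a_{ii}=-2$, $a_{ij}\ge 0$ for $i\ne j$, and $a_{ij}=2\cos(\pi/m_{ij})$ with an integer $m_{ij}\ge 2$ whenever $i\neq j$ and $a_{ij}<2$. Its \emph{cyclic products} are the numbers $a_{i_1i_2}a_{i_2i_3}\cdots a_{i_mi_1}$, $m\ge1$; its \emph{ground field} is the field $\mathbb K\subset\mathbb R$ generated over $\mathbb Q$ by all cyclic products. The matrix $A$ is \emph{V-arithmetic} if the form $\sum a_{ij}X_iY_j$ modulo its kernel has signature $(1,n)$, all cyclic products are algebraic integers, the field $\widetilde{\mathbb K}=\mathbb Q(\{a_{ij}\})$ is totally real, and for every embedding $\sigma:\widetilde{\mathbb K}\to\mathbb R$ which is not the identity on $\mathbb K$ the form with matrix $\sigma(A)$ is negative definite modulo its kernel. For integers $k\ge 2$, $s,r\ge 3$ and a real number $u$ with $2<u<14$, let $\Gamma_4^{(4)}$ be the graph with parameters $k,s,r,u$ with vertices $e_1,e_2,e_3,e_4$ and Gram matrix $$ \begin{pmatrix} -2 & u & 2\cos\frac{\pi}{k} & 0\\ u & -2 &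 2\cos\frac{\pi}{s} & 2\cos\frac{\pi}{r}\\ 2\cos\frac{\pi}{k} & 2\cos\frac{\pi}{s} & -2 & 0\\ 0 & 2\cos\frac{\pi}{r} & 0 & -2 \end{pmatrix}. $$ It is a \emph{finite edge graph} if the matrix is hyperbolic (its form has signature $(1,3)$) and the matrices obtained from it by removing $e_1$ and by removing $e_2$ are both negative definite. \textbf{Theorem.} Let $\mathbb K$ be the ground field of a V-arithmetic finite edge graph $\Gamma_4^{(4)}$ with parameters $k,s,r,u$ of minimality $14$ (i.e. $2<u<14$). Then $\mathbb K$ is a number field, and * $[\mathbb K:\mathbb Q]\le 16$ if $k=2$, $s=r=3$; * $[\mathbb K:\mathbb Q]\le 8$ if $k=2$, $(s,r)=(3,4)$ or $(4,3)$; * $[\mathbb K:\mathbb Q]\le 10$ if $k=2$, $(s,r)=(3,5)$ or $(5,3)$; * $[\mathbb K:\mathbb Q]\le 25$ if $r=k=3$; * $[\mathbb K:\mathbb Q]\le 21$ if $r=3$, $k=7$; * $[\mathbb K:\mathbb Q]\le 20$ for all remaining $k,s,r$. In particular, $[\mathbb K:\mathbb Q]\le 25$ for the ground field $\mathbb K$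 of every such graph. -/

import Mathlib

namespace VArith

open scoped Matrix

variable {ι : Type*}

/-- A fundamental matrix: a symmetric real matrix with diagonal entries `-2`, nonnegative
off-diagonal entries, and such that every off-diagonal entry smaller than `2` is
`2 cos (π / m)` for an integer `m ≥ 2`. -/
structure IsFundamental (A : Matrix ι ι ℝ) : Prop where
  symm : A.IsSymm
  diag : ∀ i, A i i = -2
  nonneg : ∀ i j, i ≠ j → 0 ≤ A i j
  cos : ∀ i j, i ≠ j → A i j < 2 → ∃ m : ℕ, 2 ≤ m ∧ A i j = 2 * Real.cos (Real.pi / m)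

/-- A matrix has minimality `t` if all its entries are smaller than `t`. -/
def HasMinimality (A : Matrix ι ι ℝ) (t : ℝ) : Prop :=
  ∀ i j, A i j < t

/-- The quadratic form `∑ a_ij X_i X_j` modulo its kernel is negative definite. -/
def NegDefModKernel [Fintype ι] (A : Matrix ι ι ℝ) : Prop :=
  ∀ x : ι → ℝ, A *ᵥ x ≠ 0 → x ⬝ᵥ (A *ᵥ x) < 0

/-- The form `∑ a_ij X_i Y_j` modulo its kernel is hyperbolic, that is, of signature `(1, n)`:
there is a vector of positive square whose orthogonal complement is negative definite modulo the
kernel. -/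
def IsHyperbolic [Fintype ι] (A : Matrix ι ι ℝ) : Prop :=
  ∃ v : ι → ℝ, 0 < v ⬝ᵥ (A *ᵥ v) ∧
    ∀ w : ι → ℝ, v ⬝ᵥ (A *ᵥ w) = 0 → A *ᵥ w ≠ 0 → w ⬝ᵥ (A *ᵥ w) < 0

/-- The cyclic product `a_{i₀ i₁} a_{i₁ i₂} ⋯ a_{i_m i₀}` (the addition in `Fin (m + 1)` is
cyclic). -/
noncomputable def cyclicProduct (A : Matrix ι ι ℝ) {m : ℕ} (i : Fin (m + 1) → ι) : ℝ :=
  ∏ j, A (i j) (i (j + 1))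

/-- The field generated over `ℚ` by all entries of `A`. -/
noncomputable def entryField (A : Matrix ι ι ℝ) : IntermediateField ℚ ℝ :=
  IntermediateField.adjoin ℚ {a | ∃ i j, a = A i j}

/-- The ground field of `A`: the field generated over `ℚ` by all cyclic products. -/
noncomputable def groundField (A : Matrix ι ι ℝ) : IntermediateField ℚ ℝ :=
  IntermediateField.adjoin ℚ {b | ∃ (m : ℕ) (i : Fin (m + 1) → ι), b = cyclicProduct A i}

theorem entry_mem (A : Matrix ι ι ℝ) (i j : ι) : A i j ∈ entryField A :=
  IntermediateField.subset_adjoin ℚ _ ⟨i, j, rfl⟩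

/-- The matrix `σ(A)` for an embedding `σ` of the field of entries into `ℝ`. -/
noncomputable def conjMatrix (A : Matrix ι ι ℝ) (σ : entryField A →+* ℝ) : Matrix ι ι ℝ :=
  Matrix.of fun i j => σ ⟨A i j, entry_mem A i j⟩

/-- V-arithmetic matrices: fundamental matrices with hyperbolic form that satisfy Vinberg's
conditions. -/
structure IsVArithmetic [Fintype ι] (A : Matrix ι ι ℝ) : Prop where
  fundamental : IsFundamental A
  hyperbolic : IsHyperbolic A
  integral : ∀ (m : ℕ) (i : Fin (m + 1) → ι), IsIntegral ℤ (cyclicProduct A i)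
  totallyReal : NumberField.IsTotallyReal (entryField A)
  negDef : ∀ σ : entryField A →+* ℝ,
    (∃ x : entryField A, (x : ℝ) ∈ groundField A ∧ σ x ≠ x) → NegDefModKernel (conjMatrix A σ)

/-- `A` is the Gram matrix of a finite edge chamber with distinguished elements `e₁`, `e₂`: it is
hyperbolic, and becomes negative definite when either `e₁` or `e₂` is removed. Equivalently, the
hyperplanes other than `e₁`, and those other than `e₂`, meet in the two finite vertices of the
edge cut out by the hyperplanes other than `e₁` and `e₂`. -/
structure IsFiniteEdge [Fintype ι] (A : Matrix ι ι ℝ) (e₁ e₂ : ι) : Prop where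
  ne : e₁ ≠ e₂
  hyperbolic : IsHyperbolic A
  negDef₁ : ∀ x : ι → ℝ, x e₁ = 0 → x ≠ 0 → x ⬝ᵥ (A *ᵥ x) < 0
  negDef₂ : ∀ x : ι → ℝ, x e₂ = 0 → x ≠ 0 → x ⬝ᵥ (A *ᵥ x) < 0

/-- The Gram matrix of the graph `Γ₄⁽⁴⁾` on the vertices `e₁, e₂, e₃, e₄` (in this order):
`e₁e₂` is a broken edge of weight `u`, `e₁e₃`, `e₂e₃`, `e₂e₄` are edges of weights `k`, `s`, `r`
(no edge for weight `2`), and `e₄` is orthogonal to `e₁` and to `e₃`. -/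
noncomputable def gramGamma44 (k s r : ℕ) (u : ℝ) : Matrix (Fin 4) (Fin 4) ℝ :=
  !![-2, u, 2 * Real.cos (Real.pi / k), 0;
     u, -2, 2 * Real.cos (Real.pi / s), 2 * Real.cos (Real.pi / r);
     2 * Real.cos (Real.pi / k), 2 * Real.cos (Real.pi / s), -2, 0;
     0, 2 * Real.cos (Real.pi / r), 0, -2]

/-- The parameters `k, s, r, u` define a V-arithmetic finite edge graph `Γ₄⁽⁴⁾` of
minimality `t`. -/
structure IsGamma44 (t : ℝ) (k s r : ℕ) (u : ℝ) : Prop where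
  two_le_k : 2 ≤ k
  three_le_s : 3 ≤ s
  three_le_r : 3 ≤ r
  two_lt_u : 2 < u
  vArithmetic : IsVArithmetic (gramGamma44 k s r u)
  edge : IsFiniteEdge (gramGamma44 k s r u) 0 1
  minimality : HasMinimality (gramGamma44 k s r u) t

/-- The set of the ground fields of all V-arithmetic finite edge graphs `Γ₄⁽⁴⁾` of
minimality `t`. -/
def FGamma44 (t : ℝ) : Set (IntermediateField ℚ ℝ) :=
  {K | ∃ (k s r : ℕ) (u : ℝ), IsGamma44 t k s r u ∧ K = groundField (gramGamma44 k s r u)}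

end VArith

/-! ### Degree bound from the norm of an algebraic integer -/

namespace VArith

/-! The method is a norm argument. If a nonzero algebraic integer of the ground field has absolute
value at most `B` and all its other conjugates have absolute value at most `ε`, then its norm is at
least 1 in absolute value, so `B * ε ^ n < 1` forces degree at most `n`
(`finrank_le_of_small_conjugates`).

Write x, y, z for the entries of weights k, s, r. The integers used are polynomials in q = u² + uxy
and t = x², both sums of cyclic products. For a nontrivial conjugate the form is negative
semidefinite; eliminating `e₃` and `e₄` gives 0 ≤ 4q + y²t = (2u + xy)² ≤ (4 − t)(4 − y² − z²),
which confines (t, q) to a triangle, or to an interval when k = 2, since then t = 0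
(`conj_gamma_bounds`). Under the identity, u < 14 bounds q.

Negative definiteness without `e₁` leaves five pairs (s, r). An affine substitution carries the
triangles of the pairs with 4 into that of (3, 3), and the triangle of (5, 3) onto that of (3, 5).
It remains to find integer polynomials that are small on these two triangles and on the intervals.
The triangles give the bound 20 for every k, so the cases stated with 25 and 21 need no separate
treatment. -/

open NumberField in
/-- A nonzero algebraic integer of a real number field `K` all of whose conjugates other than
itself are small bounds the degree of `K`. -/
theorem finrank_le_of_small_conjugates {K L : IntermediateField ℚ ℝ} (hKL : K ≤ L)
    [NumberField K] [NumberField L] [IsTotallyReal L] {α : L} (hK : (α : ℝ) ∈ K)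
    (h0 : (α : ℝ) ≠ 0) (hint : IsIntegral ℤ (α : ℝ)) {B ε : ℝ} (hε0 : 0 ≤ ε) (hε1 : ε ≤ 1)
    (hB : |(α : ℝ)| ≤ B)
    (hσ : ∀ σ : L →+* ℝ, (∃ x : L, (x : ℝ) ∈ K ∧ σ x ≠ x) → |σ α| ≤ ε)
    {n : ℕ} (hn : B * ε ^ n < 1) : Module.finrank ℚ K ≤ n := by
  classical
  by_contra! hlt
  have hB0 : 0 ≤ B := (abs_nonneg (α : ℝ)).trans hB
  let a : K := ⟨α, hK⟩
  have ha0 : a ≠ 0 := fun h => h0 (congrArg Subtype.val h)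
  have haint : IsIntegral ℤ a := by
    have : IsIntegral ℤ (algebraMap K ℝ a) := hint
    exact (isIntegral_algebraMap_iff (algebraMap K ℝ).injective).1 this
  let σ₀ : K →ₐ[ℚ] ℂ := (IsScalarTower.toAlgHom ℚ ℝ ℂ).comp K.val
  have hsmall : ∀ φ : K →ₐ[ℚ] ℂ, φ ≠ σ₀ → ‖φ a‖ ≤ ε := by
    intro φ hφ
    let _ : Algebra K L := (IntermediateField.inclusion hKL).toRingHom.toAlgebra
    have : IsScalarTower ℚ K L := IsScalarTower.of_algebraMap_eq fun x => by
      apply Subtype.ext; simp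
    have : Algebra.IsAlgebraic K L := Algebra.IsAlgebraic.tower_top (K := ℚ) K
    -- Positivity is only known for embeddings of `L`, so φ is extended to `L`; total reality makes
    -- the extension real.
    let ψ : L →+* ℂ := ComplexEmbedding.lift L (φ : K →+* ℂ)
    have hψ : ∀ x : K, ψ ⟨x, hKL x.2⟩ = φ x := fun x =>
      ComplexEmbedding.lift_algebraMap_apply L (φ : K →+* ℂ) x
    have hre : ComplexEmbedding.IsReal ψ := IsTotallyReal.complexEmbedding_isReal ψ
    have hc : ∀ x : L, ((hre.embedding x : ℝ) : ℂ) = ψ x := fun x =>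
      ComplexEmbedding.IsReal.coe_embedding_apply hre x
    have key := hσ hre.embedding (by
      by_contra! hall
      apply hφ
      ext x
      have h1 := hall ⟨x, hKL x.2⟩ x.2
      rw [← hψ x, ← hc, h1]
      rfl)
    rw [← hψ a, ← hc, Complex.norm_real]
    exact key
  have hnorm : (1 : ℝ) ≤ ‖((Algebra.norm ℚ a : ℚ) : ℂ)‖ := by
    obtain ⟨m, hm⟩ := IsIntegrallyClosed.isIntegral_iff.1 (Algebra.isIntegral_norm ℚ haint)
    have hne : Algebra.norm ℚ a ≠ 0 := Algebra.norm_ne_zero_iff.2 ha0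
    have hm0 : m ≠ 0 := by
      rintro rfl
      exact hne (by simpa using hm.symm)
    rw [← hm]
    have : (1 : ℝ) ≤ |(m : ℝ)| := by exact_mod_cast Int.one_le_abs hm0
    simpa using this
  have hprod : ((Algebra.norm ℚ a : ℚ) : ℂ) = ∏ φ : K →ₐ[ℚ] ℂ, φ a :=
    Algebra.norm_eq_prod_embeddings ℚ ℂ a
  rw [hprod, norm_prod, ← Finset.mul_prod_erase _ _ (Finset.mem_univ σ₀)] at hnorm
  have hσ₀ : ‖σ₀ a‖ ≤ B := by
    have : σ₀ a = ((α : ℝ) : ℂ) := rfl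
    rw [this, Complex.norm_real]
    exact hB
  have hrest : ∏ φ ∈ Finset.univ.erase σ₀, ‖φ a‖ ≤ ε ^ n := by
    calc ∏ φ ∈ Finset.univ.erase σ₀, ‖φ a‖ ≤ ∏ φ ∈ Finset.univ.erase σ₀, ε :=
          Finset.prod_le_prod (fun _ _ => norm_nonneg _)
            fun φ hφ => hsmall φ (Finset.ne_of_mem_erase hφ)
      _ = ε ^ (Module.finrank ℚ K - 1) := by
          rw [Finset.prod_const, Finset.card_erase_of_mem (Finset.mem_univ _), Finset.card_univ,
            AlgHom.card]
      -- The degree exceeds `n`, so at least `n` embeddings remain besides the identity.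
      _ ≤ ε ^ n := pow_le_pow_of_le_one hε0 hε1 (by omega)
  have : ‖σ₀ a‖ * ∏ φ ∈ Finset.univ.erase σ₀, ‖φ a‖ ≤ B * ε ^ n :=
    mul_le_mul hσ₀ hrest (Finset.prod_nonneg fun _ _ => norm_nonneg _) hB0
  linarith

end VArith

/-! ### Auxiliary polynomials small on triangles -/

namespace VArith

/-- Tangent-line form of weighted AM-GM: y ≤ p exp(y/p − 1), multiplied over all factors. It reduces
a bound on a product of powers of linear forms to one linear inequality; the best p are the values
of the factors at the maximum. -/
theorem prod_pow_le_prod_pow_of_sum_div_le {ι : Type*} (s : Finset ι) (y p : ι → ℝ) (m : ι → ℕ)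
    (hy : ∀ i ∈ s, 0 ≤ y i) (hp : ∀ i ∈ s, 0 < p i)
    (h : ∑ i ∈ s, m i * (y i / p i) ≤ ∑ i ∈ s, (m i : ℝ)) :
    ∏ i ∈ s, y i ^ m i ≤ ∏ i ∈ s, p i ^ m i := by
  have hfac : ∀ i ∈ s, y i ^ m i ≤ p i ^ m i * Real.exp (m i * (y i / p i - 1)) := by
    intro i hi
    have h1 : y i ≤ p i * Real.exp (y i / p i - 1) := by
      have h2 := Real.add_one_le_exp (y i / p i - 1)
      have h3 : y i = p i * (y i / p i) := (mul_div_cancel₀ (y i) (hp i hi).ne').symm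
      calc y i = p i * (y i / p i) := h3
        _ ≤ _ := mul_le_mul_of_nonneg_left (by linarith) (hp i hi).le
    calc y i ^ m i ≤ (p i * Real.exp (y i / p i - 1)) ^ m i := pow_le_pow_left₀ (hy i hi) h1 _
      _ = _ := by rw [mul_pow, ← Real.exp_nat_mul]
  calc ∏ i ∈ s, y i ^ m i ≤ ∏ i ∈ s, p i ^ m i * Real.exp (m i * (y i / p i - 1)) :=
        Finset.prod_le_prod (fun i hi => pow_nonneg (hy i hi) _) hfac
    _ = (∏ i ∈ s, p i ^ m i) * Real.exp (∑ i ∈ s, m i * (y i / p i - 1)) := by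
        rw [Finset.prod_mul_distrib, Real.exp_sum]
    _ ≤ (∏ i ∈ s, p i ^ m i) * 1 := by
        refine mul_le_mul_of_nonneg_left (Real.exp_le_one_iff.2 ?_)
          (Finset.prod_nonneg fun i hi => pow_nonneg (hp i hi).le _)
        simp only [mul_sub, mul_one, Finset.sum_sub_distrib]
        linarith
    _ = _ := mul_one _

theorem pow_mul_four_le {y₁ y₂ y₃ y₄ : ℝ} (p₁ p₂ p₃ p₄ : ℝ) (m₁ m₂ m₃ m₄ : ℕ)
    (hy₁ : 0 ≤ y₁) (hy₂ : 0 ≤ y₂) (hy₃ : 0 ≤ y₃) (hy₄ : 0 ≤ y₄)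
    (hp₁ : 0 < p₁) (hp₂ : 0 < p₂) (hp₃ : 0 < p₃) (hp₄ : 0 < p₄)
    (h : m₁ * (y₁ / p₁) + m₂ * (y₂ / p₂) + m₃ * (y₃ / p₃) + m₄ * (y₄ / p₄) ≤
      m₁ + m₂ + m₃ + m₄) :
    y₁ ^ m₁ * y₂ ^ m₂ * y₃ ^ m₃ * y₄ ^ m₄ ≤ p₁ ^ m₁ * p₂ ^ m₂ * p₃ ^ m₃ * p₄ ^ m₄ := by
  have := prod_pow_le_prod_pow_of_sum_div_le Finset.univ ![y₁, y₂, y₃, y₄] ![p₁, p₂, p₃, p₄]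
    ![m₁, m₂, m₃, m₄] (by simp [Fin.forall_fin_succ, *]) (by simp [Fin.forall_fin_succ, *])
    (by simpa [Fin.sum_univ_four] using h)
  simpa [Fin.prod_univ_four] using this

/-- The auxiliary polynomial for the triangle with vertices `(0, 0)`, `(0, 2)`, `(4, -1)`. -/
theorem abs_aux_le {p t : ℝ} (ht0 : 0 ≤ t) (ht4 : t ≤ 4) (hl : -t ≤ 4 * p)
    (hu : 4 * p ≤ 8 - 3 * t) :
    |p ^ 4 * (p + t - 2) ^ 4 * (2 * p + t - 2) ^ 2 * t| ≤ 1 / 25 := by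
  have key : ∀ a b c : ℝ, 0 < a → 0 < b → 0 < c → ∀ d : ℝ, 0 < d →
      a ^ 4 * b ^ 4 * c ^ 2 * d ≤ 1 / 25 →
      4 * (|p| / a) + 4 * (|p + t - 2| / b) + 2 * (|2 * p + t - 2| / c) + t / d ≤ 11 →
      |p| ^ 4 * |p + t - 2| ^ 4 * |2 * p + t - 2| ^ 2 * t ≤ 1 / 25 := by
    intro a b c ha hb hc d hd h1 h2
    have h3 := pow_mul_four_le a b c d 4 4 2 1 (abs_nonneg p) (abs_nonneg (p + t - 2))
      (abs_nonneg (2 * p + t - 2)) ht0 ha hb hc hd (by push_cast; linarith)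
    simp only [pow_one] at h3
    exact h3.trans h1
  rw [abs_mul, abs_mul, abs_mul, abs_pow, abs_pow, abs_pow, abs_of_nonneg ht0]
  -- The lines where a factor vanishes cut the triangle into cells on which each absolute value is
  -- linear. The constants passed to `key` are rounded values of the four factors near the maximum
  -- on the cell. The involution p ↦ 2 − p − t preserves triangle and polynomial, which explains the
  -- repeated constants.
  rcases le_total 0 p with h1 | h1 <;> rcases le_total 0 (p + t - 2) with h2 | h2
  · have h3 : 0 ≤ 2 * p + t - 2 := by linarith
    refine key 1 (1 / 3) (4 / 3) ?_ ?_ ?_ (4 / 3) ?_ ?_ ?_ <;> try norm_num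
    rw [abs_of_nonneg h1, abs_of_nonneg h2, abs_of_nonneg h3]
    linarith
  · rcases le_total 0 (2 * p + t - 2) with h3 | h3
    · refine key 1.33 0.51 0.82 ?_ ?_ ?_ 0.185 ?_ ?_ ?_ <;> try norm_num
      rw [abs_of_nonneg h1, abs_of_nonpos h2, abs_of_nonneg h3]
      linarith
    · refine key 0.51 1.33 0.82 ?_ ?_ ?_ 0.185 ?_ ?_ ?_ <;> try norm_num
      rw [abs_of_nonneg h1, abs_of_nonpos h2, abs_of_nonpos h3]
      linarith
  · rcases le_total 0 (2 * p + t - 2) with h3 | h3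
    · refine key 0.735 0.915 0.185 ?_ ?_ ?_ 3.66 ?_ ?_ ?_ <;> try norm_num
      rw [abs_of_nonpos h1, abs_of_nonneg h2, abs_of_nonneg h3]
      linarith
    · refine key 0.915 0.735 0.185 ?_ ?_ ?_ 3.66 ?_ ?_ ?_ <;> try norm_num
      rw [abs_of_nonpos h1, abs_of_nonneg h2, abs_of_nonpos h3]
      linarith
  · have h3 : 2 * p + t - 2 ≤ 0 := by linarith
    refine key (1 / 3) 1 (4 / 3) ?_ ?_ ?_ (4 / 3) ?_ ?_ ?_ <;> try norm_num
    rw [abs_of_nonpos h1, abs_of_nonpos h2, abs_of_nonpos h3]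
    linarith

/-- The auxiliary polynomial for the triangles with vertices `(0, 0)`, `(0, e)`, `(4, -1)`, where
`e` is a root of `X² - 3 X + 1`. -/
noncomputable def auxGolden (p t e : ℝ) : ℝ :=
  p ^ 3 * (p + 1 - e) ^ 1 * (p + 1) ^ 1 * (p - e + e * t) ^ 2

theorem abs_auxGolden (p t e : ℝ) : |auxGolden p t e| =
    |p| ^ 3 * |p + 1 - e| ^ 1 * |p + 1| ^ 1 * |p - e + e * t| ^ 2 := by
  simp only [auxGolden, abs_mul, abs_pow]

theorem abs_auxGolden_le {p t e : ℝ} (a b c d : ℝ) (ha : 0 < a) (hb : 0 < b) (hc : 0 < c)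
    (hd : 0 < d) {M : ℝ} (hM : a ^ 3 * b ^ 1 * c ^ 1 * d ^ 2 ≤ M)
    (h : 3 * (|p| / a) + |p + 1 - e| / b + |p + 1| / c + 2 * (|p - e + e * t| / d) ≤ 7) :
    |auxGolden p t e| ≤ M := by
  rw [abs_auxGolden]
  refine (pow_mul_four_le a b c d 3 1 1 2 (abs_nonneg _) (abs_nonneg _) (abs_nonneg _)
    (abs_nonneg _) ha hb hc hd ?_).trans hM
  push_cast
  linarith

theorem abs_auxGolden_le_of_small {p t e : ℝ} (he0 : 0.3819 ≤ e) (he1 : e ≤ 0.382) (ht0 : 0 ≤ t)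
    (ht4 : t ≤ 4) (hl : -t ≤ 4 * p) (hu : 4 * p ≤ 4 * e - (e + 1) * t) :
    |auxGolden p t e| ≤ 1 / 2000 := by
  have hw0 : 0.3819 * t ≤ e * t := mul_le_mul_of_nonneg_right he0 ht0
  have hw1 : e * t ≤ 0.382 * t := mul_le_mul_of_nonneg_right he1 ht0
  have hu' : 4 * p ≤ 4 * e - e * t - t := by linarith
  have hc : 0 ≤ p + 1 := by linarith
  -- With `w` enclosed between two multiples of `t`, every cell inequality becomes linear in p, t, w
  -- and e.
  generalize hw : e * t = w at *
  rcases le_total 0 p with h1 | h1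
  · have h2 : 0 ≤ p + 1 - e := by linarith
    rcases le_total 0 (p - e + w) with h4 | h4
    · refine abs_auxGolden_le 0.3 0.9 1.3 0.05 ?_ ?_ ?_ ?_ ?_ ?_ <;> try norm_num
      rw [hw, abs_of_nonneg h1, abs_of_nonneg h2, abs_of_nonneg hc, abs_of_nonneg h4]
      linarith
    · refine abs_auxGolden_le 0.25 0.88 1.27 0.145 ?_ ?_ ?_ ?_ ?_ ?_ <;> try norm_num
      rw [hw, abs_of_nonneg h1, abs_of_nonneg h2, abs_of_nonneg hc, abs_of_nonpos h4]
      linarith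
  rcases le_total 0 (p + 1 - e) with h2 | h2 <;> rcases le_total 0 (p - e + w) with h4 | h4
  · refine abs_auxGolden_le 0.55 0.17 0.62 0.11 ?_ ?_ ?_ ?_ ?_ ?_ <;> try norm_num
    rw [hw, abs_of_nonpos h1, abs_of_nonneg h2, abs_of_nonneg hc, abs_of_nonneg h4]
    linarith
  · refine abs_auxGolden_le 0.32 0.31 0.71 0.222 ?_ ?_ ?_ ?_ ?_ ?_ <;> try norm_num
    rw [hw, abs_of_nonpos h1, abs_of_nonneg h2, abs_of_nonneg hc, abs_of_nonpos h4]
    linarith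
  · refine abs_auxGolden_le 0.912 0.275 0.118 0.138 ?_ ?_ ?_ ?_ ?_ ?_ <;> try norm_num
    rw [hw, abs_of_nonpos h1, abs_of_nonpos h2, abs_of_nonneg hc, abs_of_nonneg h4]
    linarith
  · refine abs_auxGolden_le 0.75 0.06 0.4 0.06 ?_ ?_ ?_ ?_ ?_ ?_ <;> try norm_num
    rw [hw, abs_of_nonpos h1, abs_of_nonpos h2, abs_of_nonneg hc, abs_of_nonpos h4]
    linarith

theorem abs_auxGolden_le_of_large {p t e : ℝ} (he0 : 2.618 ≤ e) (he1 : e ≤ 2.6181) (ht0 : 0 ≤ t)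
    (ht4 : t ≤ 4) (hl : -t ≤ 4 * p) (hu : 4 * p ≤ 4 * e - (e + 1) * t) :
    |auxGolden p t e| ≤ 16 := by
  have hw0 : 2.618 * t ≤ e * t := mul_le_mul_of_nonneg_right he0 ht0
  have hw1 : e * t ≤ 2.6181 * t := mul_le_mul_of_nonneg_right he1 ht0
  have hu' : 4 * p ≤ 4 * e - e * t - t := by linarith
  have hc : 0 ≤ p + 1 := by linarith
  generalize hw : e * t = w at *
  rcases le_total p 0 with h1 | h1
  · have h2 : p + 1 - e ≤ 0 := by linarith
    rcases le_total 0 (p - e + w) with h4 | h4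
    · refine abs_auxGolden_le 0.823 2.5 0.217 6.7 ?_ ?_ ?_ ?_ ?_ ?_ <;> try norm_num
      rw [hw, abs_of_nonpos h1, abs_of_nonpos h2, abs_of_nonneg hc, abs_of_nonneg h4]
      linarith
    · refine abs_auxGolden_le 0.25 2.6 1.25 1.6 ?_ ?_ ?_ ?_ ?_ ?_ <;> try norm_num
      rw [hw, abs_of_nonpos h1, abs_of_nonpos h2, abs_of_nonneg hc, abs_of_nonpos h4]
      linarith
  rcases le_total 0 (p + 1 - e) with h2 | h2 <;> rcases le_total 0 (p - e + w) with h4 | h4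
  · refine abs_auxGolden_le 2.13 0.488 3.15 1.005 ?_ ?_ ?_ ?_ ?_ ?_ <;> try norm_num
    rw [hw, abs_of_nonneg h1, abs_of_nonneg h2, abs_of_nonneg hc, abs_of_nonneg h4]
    linarith
  · refine abs_auxGolden_le 2.3 0.53 3.4 0.57 ?_ ?_ ?_ ?_ ?_ ?_ <;> try norm_num
    rw [hw, abs_of_nonneg h1, abs_of_nonneg h2, abs_of_nonneg hc, abs_of_nonpos h4]
    linarith
  · refine abs_auxGolden_le 1.125 0.54 2.15 2.97 ?_ ?_ ?_ ?_ ?_ ?_ <;> try norm_num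
    rw [hw, abs_of_nonneg h1, abs_of_nonpos h2, abs_of_nonneg hc, abs_of_nonneg h4]
    linarith
  · refine abs_auxGolden_le 1.2 0.58 2.3 1.67 ?_ ?_ ?_ ?_ ?_ ?_ <;> try norm_num
    rw [hw, abs_of_nonneg h1, abs_of_nonpos h2, abs_of_nonneg hc, abs_of_nonpos h4]
    linarith

theorem golden_cases {e : ℝ} (he : e ^ 2 - 3 * e + 1 = 0) :
    (0.3819 ≤ e ∧ e ≤ 0.382) ∨ (2.618 ≤ e ∧ e ≤ 2.6181) := by
  rcases le_total e 1.5 with h | h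
  · left; constructor <;> nlinarith
  · right; constructor <;> nlinarith

/-- The polynomial is tiny for the small root e but not for the large one. Since e(3 − e) = 1, the
factor 3 − e is a unit, large exactly where the polynomial is tiny; the exponent 11 against the
square balances the two cases below 1/100. -/
theorem abs_auxGolden_sq_mul_le {p t e : ℝ} (he : e ^ 2 - 3 * e + 1 = 0) (ht0 : 0 ≤ t)
    (ht4 : t ≤ 4) (hl : -t ≤ 4 * p) (hu : 4 * p ≤ 4 * e - (e + 1) * t) :
    |auxGolden p t e ^ 2 * (3 - e) ^ 11| ≤ 1 / 100 := by
  rw [abs_mul, abs_pow, abs_pow]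
  rcases golden_cases he with ⟨h0, h1⟩ | ⟨h0, h1⟩
  · have hF := abs_auxGolden_le_of_small h0 h1 ht0 ht4 hl hu
    have h3 : |3 - e| ≤ 2.6181 := by rw [abs_of_nonneg] <;> linarith
    calc |auxGolden p t e| ^ 2 * |3 - e| ^ 11 ≤ (1 / 2000) ^ 2 * 2.6181 ^ 11 := by gcongr
      _ ≤ 1 / 100 := by norm_num
  · have hF := abs_auxGolden_le_of_large h0 h1 ht0 ht4 hl hu
    have h3 : |3 - e| ≤ 0.382 := by rw [abs_of_nonneg] <;> linarith
    calc |auxGolden p t e| ^ 2 * |3 - e| ^ 11 ≤ 16 ^ 2 * 0.382 ^ 11 := by gcongr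
      _ ≤ 1 / 100 := by norm_num

end VArith

/-! ### Degree bounds from triangles and intervals -/

namespace VArith

open scoped Matrix
open NumberField

section degree

variable {K L : IntermediateField ℚ ℝ}

theorem finrank_le_twenty_of_triangle (hKL : K ≤ L) [NumberField K] [NumberField L]
    [IsTotallyReal L] {p t : L} (hp : (p : ℝ) ∈ K) (ht : (t : ℝ) ∈ K)
    (hpi : IsIntegral ℤ (p : ℝ)) (hti : IsIntegral ℤ (t : ℝ)) (hpb : |(p : ℝ)| ≤ 248)
    (ht0 : 0 < (t : ℝ)) (ht4 : (t : ℝ) ≤ 4) (h0 : (p : ℝ) ≠ 0) (h1 : (p + t - 2 : ℝ) ≠ 0)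
    (h2 : (2 * p + t - 2 : ℝ) ≠ 0)
    (hσ : ∀ σ : L →+* ℝ, (∃ x : L, (x : ℝ) ∈ K ∧ σ x ≠ x) →
      0 ≤ σ t ∧ σ t ≤ 4 ∧ -σ t ≤ 4 * σ p ∧ 4 * σ p ≤ 8 - 3 * σ t) :
    Module.finrank ℚ K ≤ 20 := by
  have h2K : (2 : ℝ) ∈ K := ofNat_mem K 2
  have h2i : IsIntegral ℤ (2 : ℝ) := isIntegral_algebraMap (R := ℤ) (x := (2 : ℤ))
  have hp' := abs_le.1 hpb
  have hb1 : |(p + t - 2 : ℝ)| ≤ 250 := abs_le.2 ⟨by linarith, by linarith⟩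
  have hb2 : |(2 * p + t - 2 : ℝ)| ≤ 500 := abs_le.2 ⟨by linarith, by linarith⟩
  have htb : |(t : ℝ)| ≤ 4 := by rwa [abs_of_pos ht0]
  refine finrank_le_of_small_conjugates hKL
    (α := p ^ 4 * (p + t - 2) ^ 4 * (2 * p + t - 2) ^ 2 * t)
    (B := 248 ^ 4 * 250 ^ 4 * 500 ^ 2 * 4) (ε := 1 / 25) ?_ ?_ ?_ (by norm_num) (by norm_num)
    ?_ ?_ (by norm_num)
  · push_cast
    exact mul_mem (mul_mem (mul_mem (pow_mem hp _) (pow_mem (sub_mem (add_mem hp ht) h2K) _))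
      (pow_mem (sub_mem (add_mem (mul_mem h2K hp) ht) h2K) _)) ht
  · push_cast
    exact mul_ne_zero (mul_ne_zero (mul_ne_zero (pow_ne_zero _ h0) (pow_ne_zero _ h1))
      (pow_ne_zero _ h2)) ht0.ne'
  · push_cast
    exact (((hpi.pow _).mul (((hpi.add hti).sub h2i).pow _)).mul
      ((((h2i.mul hpi).add hti).sub h2i).pow _)).mul hti
  · push_cast
    rw [abs_mul, abs_mul, abs_mul, abs_pow, abs_pow, abs_pow]
    gcongr
    exacts [hb1, hb2]
  -- The identity p ↦ σ p, t ↦ σ t lands in the triangle, where the auxiliary polynomial is at most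
  -- 1/25.
  · intro σ hn
    obtain ⟨a, b, c, d⟩ := hσ σ hn
    simpa only [map_add, map_sub, map_mul, map_pow, map_ofNat] using abs_aux_le a b c d

theorem finrank_le_twenty_of_golden_triangle (hKL : K ≤ L) [NumberField K] [NumberField L]
    [IsTotallyReal L] {p t e : L} (hp : (p : ℝ) ∈ K) (ht : (t : ℝ) ∈ K) (he : (e : ℝ) ∈ K)
    (hpi : IsIntegral ℤ (p : ℝ)) (hti : IsIntegral ℤ (t : ℝ)) (hei : IsIntegral ℤ (e : ℝ))
    (hpb : |(p : ℝ)| ≤ 248.5) (ht0 : 0 ≤ (t : ℝ)) (ht4 : (t : ℝ) ≤ 4)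
    (hee : (e : ℝ) ^ 2 - 3 * e + 1 = 0) (he1 : (e : ℝ) ≤ 1)
    (h0 : (p : ℝ) ≠ 0) (h1 : (p + 1 - e : ℝ) ≠ 0) (h2 : (p + 1 : ℝ) ≠ 0)
    (h3 : (p - e + e * t : ℝ) ≠ 0)
    (hσ : ∀ σ : L →+* ℝ, (∃ x : L, (x : ℝ) ∈ K ∧ σ x ≠ x) →
      0 ≤ σ t ∧ σ t ≤ 4 ∧ -σ t ≤ 4 * σ p ∧ 4 * σ p ≤ 4 * σ e - (σ e + 1) * σ t) :
    Module.finrank ℚ K ≤ 20 := by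
  have h3K : (3 : ℝ) ∈ K := ofNat_mem K 3
  have h3i : IsIntegral ℤ (3 : ℝ) := isIntegral_algebraMap (R := ℤ) (x := (3 : ℤ))
  have hei' : 0.3819 ≤ (e : ℝ) ∧ (e : ℝ) ≤ 0.382 := by
    rcases golden_cases hee with h | h
    · exact h
    · linarith [h.1]
  obtain ⟨hel, heu⟩ := hei'
  have hw0 : 0 ≤ (e * t : ℝ) := by positivity
  have hw1 : (e * t : ℝ) ≤ 1.6 := by nlinarith
  have hp' := abs_le.1 hpb
  have hb1 : |(p + 1 - e : ℝ)| ≤ 251 := abs_le.2 ⟨by linarith, by linarith⟩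
  have hb2 : |(p + 1 : ℝ)| ≤ 251 := abs_le.2 ⟨by linarith, by linarith⟩
  have hb3 : |(p - e + e * t : ℝ)| ≤ 251 := abs_le.2 ⟨by linarith, by linarith⟩
  have hb4 : |(3 - e : ℝ)| ≤ 2.6181 := abs_le.2 ⟨by linarith, by linarith⟩
  refine finrank_le_of_small_conjugates hKL
    (α := (p ^ 3 * (p + 1 - e) ^ 1 * (p + 1) ^ 1 * (p - e + e * t) ^ 2) ^ 2 * (3 - e) ^ 11)
    (B := (248.5 ^ 3 * 251 ^ 1 * 251 ^ 1 * 251 ^ 2) ^ 2 * 2.6181 ^ 11) (ε := 1 / 100) ?_ ?_ ?_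
    (by norm_num) (by norm_num) ?_ ?_ (by norm_num)
  · push_cast
    exact mul_mem (pow_mem (mul_mem (mul_mem (mul_mem (pow_mem hp _)
      (pow_mem (sub_mem (add_mem hp (one_mem K)) he) _)) (pow_mem (add_mem hp (one_mem K)) _))
      (pow_mem (add_mem (sub_mem hp he) (mul_mem he ht)) _)) _) (pow_mem (sub_mem h3K he) _)
  · push_cast
    exact mul_ne_zero (pow_ne_zero _ (mul_ne_zero (mul_ne_zero (mul_ne_zero (pow_ne_zero _ h0)
      (pow_ne_zero _ h1)) (pow_ne_zero _ h2)) (pow_ne_zero _ h3)))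
      (pow_ne_zero _ (by linarith : (0 : ℝ) < 3 - e).ne')
  · push_cast
    exact (((((hpi.pow _).mul (((hpi.add isIntegral_one).sub hei).pow _)).mul
      ((hpi.add isIntegral_one).pow _)).mul (((hpi.sub hei).add (hei.mul hti)).pow _)).pow _).mul
      ((h3i.sub hei).pow _)
  · push_cast
    simp only [abs_mul, abs_pow]
    gcongr
    exact hb4
  · intro σ hn
    obtain ⟨a, b, c, d⟩ := hσ σ hn
    have hσe : σ e ^ 2 - 3 * σ e + 1 = 0 := by
      have : e ^ 2 - 3 * e + 1 = 0 := Subtype.ext (by push_cast; exact hee)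
      simpa only [map_add, map_sub, map_mul, map_pow, map_one, map_zero, map_ofNat]
        using congrArg σ this
    simpa only [auxGolden, map_add, map_sub, map_mul, map_pow, map_one, map_ofNat] using
      abs_auxGolden_sq_mul_le hσe a b c d

/-- With w = (q − 1)² ∈ [0, 1], the polynomial q(q − 1)²(q − 2) equals w(w − 1), hence lies in
[−1/4, 0]. -/
theorem finrank_le_sixteen_of_interval (hKL : K ≤ L) [NumberField K] [NumberField L]
    [IsTotallyReal L] {q : L} (hq : (q : ℝ) ∈ K) (hqi : IsIntegral ℤ (q : ℝ))
    (hq2 : 2 < (q : ℝ)) (hqb : (q : ℝ) ≤ 196)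
    (hσ : ∀ σ : L →+* ℝ, (∃ x : L, (x : ℝ) ∈ K ∧ σ x ≠ x) → 0 ≤ σ q ∧ σ q ≤ 2) :
    Module.finrank ℚ K ≤ 16 := by
  have h2K : (2 : ℝ) ∈ K := ofNat_mem K 2
  have h2i : IsIntegral ℤ (2 : ℝ) := isIntegral_algebraMap (R := ℤ) (x := (2 : ℤ))
  refine finrank_le_of_small_conjugates hKL (α := q * (q - 1) ^ 2 * (q - 2))
    (B := 196 * 195 ^ 2 * 194) (ε := 1 / 4) ?_ ?_ ?_ (by norm_num) (by norm_num)
    ?_ ?_ (by norm_num)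
  · push_cast
    exact mul_mem (mul_mem hq (pow_mem (sub_mem hq (one_mem K)) _)) (sub_mem hq h2K)
  · push_cast
    have h1 : (0 : ℝ) < q - 1 := by linarith
    have h2 : (0 : ℝ) < q - 2 := by linarith
    have h3 : (0 : ℝ) < q := by linarith
    positivity
  · push_cast
    exact (hqi.mul ((hqi.sub isIntegral_one).pow _)).mul (hqi.sub h2i)
  · push_cast
    rw [abs_mul, abs_mul, abs_pow]
    have h1 : |(q : ℝ)| ≤ 196 := abs_le.2 ⟨by linarith, by linarith⟩
    have h2 : |(q - 1 : ℝ)| ≤ 195 := abs_le.2 ⟨by linarith, by linarith⟩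
    have h3 : |(q - 2 : ℝ)| ≤ 194 := abs_le.2 ⟨by linarith, by linarith⟩
    gcongr
    exact h3
  · intro σ hn
    obtain ⟨a, b⟩ := hσ σ hn
    simp only [map_mul, map_pow, map_sub, map_one, map_ofNat]
    have h1 : 0 ≤ σ q * (2 - σ q) := mul_nonneg a (by linarith)
    have h2 : 0 ≤ σ q * (2 - σ q) * (σ q - 1) ^ 2 := mul_nonneg h1 (sq_nonneg _)
    rw [abs_le]
    constructor
    · nlinarith [sq_nonneg ((σ q - 1) ^ 2 - 1 / 2)]
    · nlinarith

theorem finrank_le_eight_of_interval (hKL : K ≤ L) [NumberField K] [NumberField L]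
    [IsTotallyReal L] {q : L} (hq : (q : ℝ) ∈ K) (hqi : IsIntegral ℤ (q : ℝ))
    (hq1 : 1 < (q : ℝ)) (hqb : (q : ℝ) ≤ 196)
    (hσ : ∀ σ : L →+* ℝ, (∃ x : L, (x : ℝ) ∈ K ∧ σ x ≠ x) → 0 ≤ σ q ∧ σ q ≤ 1) :
    Module.finrank ℚ K ≤ 8 := by
  refine finrank_le_of_small_conjugates hKL (α := q * (q - 1))
    (B := 196 * 195) (ε := 1 / 4) ?_ ?_ ?_ (by norm_num) (by norm_num)
    ?_ ?_ (by norm_num)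
  · push_cast
    exact mul_mem hq (sub_mem hq (one_mem K))
  · push_cast
    have h1 : (0 : ℝ) < q - 1 := by linarith
    have h3 : (0 : ℝ) < q := by linarith
    positivity
  · push_cast
    exact hqi.mul (hqi.sub isIntegral_one)
  · push_cast
    rw [abs_mul]
    have h1 : |(q : ℝ)| ≤ 196 := abs_le.2 ⟨by linarith, by linarith⟩
    have h2 : |(q - 1 : ℝ)| ≤ 195 := abs_le.2 ⟨by linarith, by linarith⟩
    gcongr
  · intro σ hn
    obtain ⟨a, b⟩ := hσ σ hn
    simp only [map_mul, map_sub, map_one]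
    rw [abs_le]
    constructor
    · nlinarith [sq_nonneg (σ q - 1 / 2)]
    · nlinarith

/-- On [0, e] one has |q(q − e)| ≤ e²/4, and the square of the unit 3 − e = 1/e rescales this to 1/4
for both conjugates of e. -/
theorem finrank_le_ten_of_golden_interval (hKL : K ≤ L) [NumberField K] [NumberField L]
    [IsTotallyReal L] {q e : L} (hq : (q : ℝ) ∈ K) (he : (e : ℝ) ∈ K)
    (hqi : IsIntegral ℤ (q : ℝ)) (hei : IsIntegral ℤ (e : ℝ))
    (hee : (e : ℝ) ^ 2 - 3 * e + 1 = 0) (he1 : (e : ℝ) ≤ 1)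
    (hq1 : 1 < (q : ℝ)) (hqb : (q : ℝ) ≤ 196)
    (hσ : ∀ σ : L →+* ℝ, (∃ x : L, (x : ℝ) ∈ K ∧ σ x ≠ x) → 0 ≤ σ q ∧ σ q ≤ σ e) :
    Module.finrank ℚ K ≤ 10 := by
  have h3K : (3 : ℝ) ∈ K := ofNat_mem K 3
  have h3i : IsIntegral ℤ (3 : ℝ) := isIntegral_algebraMap (R := ℤ) (x := (3 : ℤ))
  have he0 : 0 ≤ (e : ℝ) := by nlinarith
  refine finrank_le_of_small_conjugates hKL (α := q * (q - e) * (3 - e) ^ 2)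
    (B := 196 * 196 * 3 ^ 2) (ε := 1 / 4) ?_ ?_ ?_ (by norm_num) (by norm_num)
    ?_ ?_ (by norm_num)
  · push_cast
    exact mul_mem (mul_mem hq (sub_mem hq he)) (pow_mem (sub_mem h3K he) _)
  · push_cast
    have h1 : (0 : ℝ) < q - e := by linarith
    have h2 : (0 : ℝ) < 3 - e := by linarith
    have h3 : (0 : ℝ) < q := by linarith
    positivity
  · push_cast
    exact (hqi.mul (hqi.sub hei)).mul ((h3i.sub hei).pow _)
  · push_cast
    rw [abs_mul, abs_mul, abs_pow]
    have h1 : |(q : ℝ)| ≤ 196 := abs_le.2 ⟨by linarith, by linarith⟩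
    have h2 : |(q - e : ℝ)| ≤ 196 := abs_le.2 ⟨by linarith, by linarith⟩
    have h3 : |(3 - e : ℝ)| ≤ 3 := abs_le.2 ⟨by linarith, by linarith⟩
    gcongr
    exact h3
  · intro σ hn
    obtain ⟨a, b⟩ := hσ σ hn
    have hσe : σ e ^ 2 - 3 * σ e + 1 = 0 := by
      have : e ^ 2 - 3 * e + 1 = 0 := Subtype.ext (by push_cast; exact hee)
      simpa only [map_add, map_sub, map_mul, map_pow, map_one, map_zero, map_ofNat]
        using congrArg σ this
    simp only [map_mul, map_pow, map_sub, map_ofNat]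
    have hu : σ e * (3 - σ e) = 1 := by linarith
    have h1 : 0 ≤ σ q * (σ e - σ q) := mul_nonneg a (by linarith)
    have h2 : σ q * (σ e - σ q) ≤ σ e ^ 2 / 4 := by nlinarith [sq_nonneg (σ q - σ e / 2)]
    have h3 : σ q * (σ e - σ q) * (3 - σ e) ^ 2 ≤ 1 / 4 := by
      calc σ q * (σ e - σ q) * (3 - σ e) ^ 2 ≤ σ e ^ 2 / 4 * (3 - σ e) ^ 2 := by gcongr
        _ = (σ e * (3 - σ e)) ^ 2 / 4 := by ring
        _ = 1 / 4 := by rw [hu]; norm_num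
    have h4 : 0 ≤ σ q * (σ e - σ q) * (3 - σ e) ^ 2 := mul_nonneg h1 (sq_nonneg _)
    rw [abs_le]
    constructor <;> linarith

end degree

end VArith

/-! ### Cyclic products, conjugate forms and admissible (s, r) -/

namespace VArith

open scoped Matrix
open NumberField

section cyclic

variable {ι : Type*} (A : Matrix ι ι ℝ)

theorem cyclicProduct_two (i j : ι) : cyclicProduct A ![i, j] = A i j * A j i := by
  simp [cyclicProduct, Fin.prod_univ_two]

theorem cyclicProduct_three (i j k : ι) :
    cyclicProduct A ![i, j, k] = A i j * A j k * A k i := by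
  simp [cyclicProduct, Fin.prod_univ_three]

theorem mul_mem_groundField (i j : ι) : A i j * A j i ∈ groundField A :=
  IntermediateField.subset_adjoin ℚ _ ⟨1, ![i, j], (cyclicProduct_two A i j).symm⟩

theorem mul_mul_mem_groundField (i j k : ι) : A i j * A j k * A k i ∈ groundField A :=
  IntermediateField.subset_adjoin ℚ _ ⟨2, ![i, j, k], (cyclicProduct_three A i j k).symm⟩

theorem groundField_le_entryField : groundField A ≤ entryField A := by
  refine IntermediateField.adjoin_le_iff.2 ?_
  rintro _ ⟨m, i, rfl⟩
  exact prod_mem fun j _ => entry_mem A _ _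

variable {A} [Fintype ι]

theorem IsVArithmetic.isIntegral_mul (h : IsVArithmetic A) (i j : ι) : IsIntegral ℤ (A i j * A j i) :=
  cyclicProduct_two A i j ▸ h.integral 1 ![i, j]

theorem IsVArithmetic.isIntegral_mul_mul (h : IsVArithmetic A) (i j k : ι) : IsIntegral ℤ (A i j * A j k * A k i) :=
  cyclicProduct_three A i j k ▸ h.integral 2 ![i, j, k]

theorem IsVArithmetic.numberField_entryField (h : IsVArithmetic A) : NumberField (entryField A) := by
  have hfin : {a | ∃ i j, a = A i j}.Finite := by
    refine (Set.finite_range fun x : ι × ι => A x.1 x.2).subset ?_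
    rintro _ ⟨i, j, rfl⟩
    exact ⟨(i, j), rfl⟩
  have := hfin.to_subtype
  have : FiniteDimensional ℚ (entryField A) := by
    refine IntermediateField.finiteDimensional_adjoin ?_
    rintro _ ⟨i, j, rfl⟩
    have h1 := h.isIntegral_mul i j
    -- By symmetry the cyclic product of length two is the square of the entry, so the entry itself
    -- is algebraic.
    rw [h.fundamental.symm.apply i j, ← sq] at h1
    exact (h1.of_pow two_pos).tower_top
  exact ⟨⟩

theorem IsVArithmetic.numberField_groundField (h : IsVArithmetic A) : NumberField (groundField A) := by
  have := h.numberField_entryField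
  have : FiniteDimensional ℚ (groundField A) :=
    Module.Finite.of_injective
      (IntermediateField.inclusion (groundField_le_entryField A)).toLinearMap
      (IntermediateField.inclusion_injective (groundField_le_entryField A))
  exact ⟨⟩

end cyclic

/-- The entry `a_ij` as an element of the field of entries. -/
noncomputable def entry {ι : Type*} (A : Matrix ι ι ℝ) (i j : ι) : entryField A :=
  ⟨A i j, entry_mem A i j⟩

section gamma

variable {k s r : ℕ} {u : ℝ}

/-- The conjugates of the form of `Γ₄⁽⁴⁾` are negative semidefinite. -/
theorem IsVArithmetic.form_nonpos (h : IsVArithmetic (gramGamma44 k s r u))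
    (σ : entryField (gramGamma44 k s r u) →+* ℝ)
    (hσ : ∃ x : entryField (gramGamma44 k s r u),
      (x : ℝ) ∈ groundField (gramGamma44 k s r u) ∧ σ x ≠ x) (a b c d : ℝ) :
    σ (entry _ 0 1) * a * b + σ (entry _ 0 2) * a * c + σ (entry _ 1 2) * b * c +
      σ (entry _ 1 3) * b * d ≤ a ^ 2 + b ^ 2 + c ^ 2 + d ^ 2 := by
  have hneg := h.negDef σ hσ
  let A := gramGamma44 k s r u
  have hM : conjMatrix A σ = !![-2, σ (entry A 0 1), σ (entry A 0 2), 0;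
      σ (entry A 0 1), -2, σ (entry A 1 2), σ (entry A 1 3);
      σ (entry A 0 2), σ (entry A 1 2), -2, 0;
      0, σ (entry A 1 3), 0, -2] := by
    have h2 : ∀ x : entryField A, (x : ℝ) = -2 → σ x = -2 := by
      intro x hx
      have : x = -2 := Subtype.ext hx
      rw [this, map_neg, map_ofNat]
    have h0 : ∀ x : entryField A, (x : ℝ) = 0 → σ x = 0 := by
      intro x hx
      have : x = 0 := Subtype.ext hx
      rw [this, map_zero]
    ext i j
    fin_cases i <;> fin_cases j <;> first | rfl | exact h2 _ rfl | exact h0 _ rfl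
  have hq : ![a, b, c, d] ⬝ᵥ (conjMatrix A σ *ᵥ ![a, b, c, d]) ≤ 0 := by
    by_cases hz : conjMatrix A σ *ᵥ ![a, b, c, d] = 0
    · rw [hz, dotProduct_zero]
    · exact (hneg _ hz).le
  rw [hM] at hq
  simp [A, Matrix.mulVec, dotProduct, Fin.sum_univ_four] at hq
  linarith

theorem IsVArithmetic.conj_bounds (h : IsVArithmetic (gramGamma44 k s r u))
    (σ : entryField (gramGamma44 k s r u) →+* ℝ)
    (hσ : ∃ x : entryField (gramGamma44 k s r u),
      (x : ℝ) ∈ groundField (gramGamma44 k s r u) ∧ σ x ≠ x)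
    (hpos : 0 < 4 - σ (entry _ 1 2) ^ 2 - σ (entry _ 1 3) ^ 2) :
    σ (entry _ 0 2) ^ 2 ≤ 4 ∧
    (2 * σ (entry _ 0 1) + σ (entry _ 0 2) * σ (entry _ 1 2)) ^ 2 ≤
      (4 - σ (entry _ 0 2) ^ 2) * (4 - σ (entry _ 1 2) ^ 2 - σ (entry _ 1 3) ^ 2) := by
  have hf := h.form_nonpos σ hσ
  generalize σ (entry _ 0 1) = U at *
  generalize σ (entry _ 0 2) = X at *
  generalize σ (entry _ 1 2) = Y at *
  generalize σ (entry _ 1 3) = Z at *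
  constructor
  -- This vector gives the semidefiniteness of the block on `e₁`, `e₃`.
  · have := hf 2 0 X 0
    nlinarith
  · set D := 4 - Y ^ 2 - Z ^ 2 with hD
    set H := 2 * U + X * Y with hH
    -- The last two coordinates maximise the form for given a, b, namely c = (Xa + Yb)/2 and d =
    -- Zb/2. What is left is −((4 − X²)a² − 2Hab + Db²)/4, maximal in b at b = Ha/D.
    have h1 := hf (2 * D) (2 * H) (X * D + Y * H) (Z * H)
    have h2 : D * (H ^ 2 - (4 - X ^ 2) * D) ≤ 0 := by
      have : D * (H ^ 2 - (4 - X ^ 2) * D) =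
          (U * (2 * D) * (2 * H) + X * (2 * D) * (X * D + Y * H) +
            Y * (2 * H) * (X * D + Y * H) + Z * (2 * H) * (Z * H)) -
          ((2 * D) ^ 2 + (2 * H) ^ 2 + (X * D + Y * H) ^ 2 + (Z * H) ^ 2) := by
        rw [hH, hD]; ring
      linarith
    nlinarith

theorem IsFiniteEdge.cos_sq_add_cos_sq_lt (h : IsFiniteEdge (gramGamma44 k s r u) 0 1) :
    (2 * Real.cos (Real.pi / s)) ^ 2 + (2 * Real.cos (Real.pi / r)) ^ 2 < 4 := by
  have h1 := h.negDef₁ ![0, 2, 2 * Real.cos (Real.pi / s), 2 * Real.cos (Real.pi / r)] rfl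
    (fun hz => by simpa using congrFun hz 1)
  simp [gramGamma44, Matrix.mulVec, dotProduct, Fin.sum_univ_four] at h1
  nlinarith

theorem le_two_mul_cos_pi_div {m n : ℕ} (hm : 1 ≤ m) (hmn : m ≤ n) :
    2 * Real.cos (Real.pi / m) ≤ 2 * Real.cos (Real.pi / n) := by
  have hm' : (1 : ℝ) ≤ m := by exact_mod_cast hm
  have hmn' : (m : ℝ) ≤ n := by exact_mod_cast hmn
  have : Real.pi / n ≤ Real.pi / m := by gcongr
  have := Real.cos_le_cos_of_nonneg_of_le_pi (by positivity)
    (div_le_self Real.pi_pos.le hm') this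
  linarith

/-- The block on `e₂`, `e₃`, `e₄` is a spherical Coxeter diagram: y² + z² < 4, with 4cos²(π/n) at
least 1, 2, 3 for n at least 3, 4, 6. -/
theorem IsFiniteEdge.parameters (h : IsFiniteEdge (gramGamma44 k s r u) 0 1) (hs : 3 ≤ s)
    (hr : 3 ≤ r) :
    (s = 3 ∧ r = 3) ∨ (s = 3 ∧ r = 4) ∨ (s = 4 ∧ r = 3) ∨ (s = 3 ∧ r = 5) ∨ (s = 5 ∧ r = 3) := by
  have hlt := h.cos_sq_add_cos_sq_lt
  have h3 : ∀ n : ℕ, 3 ≤ n → 1 ≤ (2 * Real.cos (Real.pi / n)) ^ 2 := by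
    intro n hn
    have := le_two_mul_cos_pi_div (by norm_num) hn
    rw [Nat.cast_ofNat, Real.cos_pi_div_three] at this
    nlinarith
  have h4 : ∀ n : ℕ, 4 ≤ n → 2 ≤ (2 * Real.cos (Real.pi / n)) ^ 2 := by
    intro n hn
    have := le_two_mul_cos_pi_div (by norm_num) hn
    rw [Nat.cast_ofNat, Real.cos_pi_div_four] at this
    nlinarith [Real.sq_sqrt (zero_le_two (α := ℝ)), Real.sqrt_nonneg 2]
  have h6 : ∀ n : ℕ, 6 ≤ n → 3 ≤ (2 * Real.cos (Real.pi / n)) ^ 2 := by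
    intro n hn
    have := le_two_mul_cos_pi_div (by norm_num) hn
    rw [Nat.cast_ofNat, Real.cos_pi_div_six] at this
    nlinarith [Real.sq_sqrt (zero_le_three (α := ℝ)), Real.sqrt_nonneg 3]
  have hs3 := h3 s hs
  have hr3 := h3 r hr
  have hs6 : s < 6 := by
    by_contra! hc
    linarith [h6 s hc]
  have hr6 : r < 6 := by
    by_contra! hc
    linarith [h6 r hc]
  have h44 : s = 3 ∨ r = 3 := by
    by_contra! hc
    linarith [h4 s (by omega), h4 r (by omega)]
  omega

end gamma

theorem two_mul_cos_pi_div_three_sq : (2 * Real.cos (Real.pi / (3 : ℕ))) ^ 2 = 1 := by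
  rw [Nat.cast_ofNat, Real.cos_pi_div_three]; norm_num

theorem two_mul_cos_pi_div_four_sq : (2 * Real.cos (Real.pi / (4 : ℕ))) ^ 2 = 2 := by
  rw [Nat.cast_ofNat, Real.cos_pi_div_four, mul_div_cancel₀ _ two_ne_zero,
    Real.sq_sqrt zero_le_two]

theorem golden_two_mul_cos_pi_div_five :
    (3 - (2 * Real.cos (Real.pi / (5 : ℕ))) ^ 2) ^ 2 -
      3 * (3 - (2 * Real.cos (Real.pi / (5 : ℕ))) ^ 2) + 1 = 0 := by
  rw [Nat.cast_ofNat, Real.cos_pi_div_five]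
  have := Real.sq_sqrt (show (0 : ℝ) ≤ 5 by norm_num)
  generalize √5 = v at *
  have hv : (2 * ((1 + v) / 4)) ^ 2 = (3 + v) / 2 := by linear_combination this / 4
  rw [hv]
  linear_combination this / 4

end VArith

/-! ### The elements q and t, and the five cases -/

namespace VArith

open NumberField

section gamma

variable (k s r : ℕ) (u : ℝ)

/-- The element `u² + 4 u cos (π / k) cos (π / s)` of the ground field of `Γ₄⁽⁴⁾`. -/
noncomputable def gammaQ : entryField (gramGamma44 k s r u) :=
  entry _ 0 1 ^ 2 + entry _ 0 1 * entry _ 0 2 * entry _ 1 2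

/-- The element `4 cos² (π / k)` of the ground field of `Γ₄⁽⁴⁾`. -/
noncomputable def gammaT : entryField (gramGamma44 k s r u) :=
  entry _ 0 2 ^ 2

variable {k s r u}

theorem coe_gammaQ : (gammaQ k s r u : ℝ) =
    u ^ 2 + u * (2 * Real.cos (Real.pi / k)) * (2 * Real.cos (Real.pi / s)) := rfl

theorem coe_gammaT : (gammaT k s r u : ℝ) = (2 * Real.cos (Real.pi / k)) ^ 2 := rfl

theorem sq_mem_groundField (h : IsVArithmetic (gramGamma44 k s r u)) (i j : Fin 4) :
    ((entry (gramGamma44 k s r u) i j ^ 2 : entryField _) : ℝ) ∈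
      groundField (gramGamma44 k s r u) := by
  have h1 := mul_mem_groundField (gramGamma44 k s r u) i j
  rw [h.fundamental.symm.apply i j, ← sq] at h1
  exact h1

theorem isIntegral_sq (h : IsVArithmetic (gramGamma44 k s r u)) (i j : Fin 4) :
    IsIntegral ℤ ((entry (gramGamma44 k s r u) i j ^ 2 : entryField _) : ℝ) := by
  have h1 := h.isIntegral_mul i j
  rw [h.fundamental.symm.apply i j, ← sq] at h1
  exact h1

theorem coe_gammaQ_eq_cyclic : (gammaQ k s r u : ℝ) =
    gramGamma44 k s r u 0 1 * gramGamma44 k s r u 1 0 +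
      gramGamma44 k s r u 0 1 * gramGamma44 k s r u 1 2 * gramGamma44 k s r u 2 0 := by
  rw [coe_gammaQ]
  simp [gramGamma44]
  ring

theorem gammaQ_mem : (gammaQ k s r u : ℝ) ∈ groundField (gramGamma44 k s r u) := by
  rw [coe_gammaQ_eq_cyclic]
  exact add_mem (mul_mem_groundField _ _ _) (mul_mul_mem_groundField _ _ _ _)

theorem isIntegral_gammaQ (h : IsVArithmetic (gramGamma44 k s r u)) :
    IsIntegral ℤ (gammaQ k s r u : ℝ) := by
  rw [coe_gammaQ_eq_cyclic]
  exact (h.isIntegral_mul _ _).add (h.isIntegral_mul_mul _ _ _)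

theorem conj_gamma_bounds (h : IsVArithmetic (gramGamma44 k s r u))
    (σ : entryField (gramGamma44 k s r u) →+* ℝ)
    (hσ : ∃ x : entryField (gramGamma44 k s r u),
      (x : ℝ) ∈ groundField (gramGamma44 k s r u) ∧ σ x ≠ x) {Y Z : ℝ}
    (hY : σ (entry _ 1 2) ^ 2 = Y) (hZ : σ (entry _ 1 3) ^ 2 = Z) (hpos : 0 < 4 - Y - Z) :
    0 ≤ σ (gammaT k s r u) ∧ σ (gammaT k s r u) ≤ 4 ∧
    0 ≤ 4 * σ (gammaQ k s r u) + Y * σ (gammaT k s r u) ∧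
    4 * σ (gammaQ k s r u) + Y * σ (gammaT k s r u) ≤
      (4 - σ (gammaT k s r u)) * (4 - Y - Z) := by
  subst hY hZ
  obtain ⟨h1, h2⟩ := h.conj_bounds σ hσ hpos
  have hT : σ (gammaT k s r u) = σ (entry _ 0 2) ^ 2 := map_pow σ _ 2
  have hQ : 4 * σ (gammaQ k s r u) + σ (entry _ 1 2) ^ 2 * σ (gammaT k s r u) =
      (2 * σ (entry _ 0 1) + σ (entry _ 0 2) * σ (entry _ 1 2)) ^ 2 := by
    rw [hT, gammaQ]
    simp only [map_add, map_mul, map_pow]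
    ring
  rw [hQ, hT]
  exact ⟨sq_nonneg _, h1, sq_nonneg _, h2⟩

theorem map_sq_of_coe_eq_three {L : IntermediateField ℚ ℝ} (σ : L →+* ℝ) {x : L}
    (hx : (x : ℝ) = 2 * Real.cos (Real.pi / (3 : ℕ))) : σ x ^ 2 = 1 := by
  have : x ^ 2 = 1 := Subtype.ext (by
    push_cast
    rw [hx, two_mul_cos_pi_div_three_sq])
  rw [← map_pow, this, map_one]

theorem map_sq_of_coe_eq_four {L : IntermediateField ℚ ℝ} (σ : L →+* ℝ) {x : L}
    (hx : (x : ℝ) = 2 * Real.cos (Real.pi / (4 : ℕ))) : σ x ^ 2 = 2 := by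
  have : x ^ 2 = 2 := Subtype.ext (by
    push_cast
    rw [hx, two_mul_cos_pi_div_four_sq]
    rfl)
  rw [← map_pow, this, map_ofNat]

/-- Bounds for the elements `q`, `t` under the identity embedding. -/
theorem IsGamma44.gamma_bounds (h : IsGamma44 14 k s r u) :
    4 < (gammaQ k s r u : ℝ) ∧ (gammaQ k s r u : ℝ) ≤ 244.5 ∧
    0 ≤ (gammaT k s r u : ℝ) ∧ (gammaT k s r u : ℝ) < 4 := by
  rw [coe_gammaQ, coe_gammaT]
  have hu := h.two_lt_u
  have hu' : u < 14 := h.minimality 0 1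
  have hx0 : 0 ≤ 2 * Real.cos (Real.pi / k) := by
    have := le_two_mul_cos_pi_div (by norm_num) h.two_le_k
    rwa [Nat.cast_ofNat, Real.cos_pi_div_two, mul_zero] at this
  have hx2 : 2 * Real.cos (Real.pi / k) < 2 := by
    have hk : (2 : ℝ) ≤ k := by exact_mod_cast h.two_le_k
    have h1 : 0 < Real.pi / k := by have := Real.pi_pos; positivity
    have h2 : Real.cos (Real.pi / k) < Real.cos 0 :=
      Real.cos_lt_cos_of_nonneg_of_le_pi le_rfl
        (div_le_self Real.pi_pos.le (by linarith)) h1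
    rw [Real.cos_zero] at h2
    linarith
  have h1 : ∀ n : ℕ, 3 ≤ n → 1 ≤ 2 * Real.cos (Real.pi / n) := by
    intro n hn
    have := le_two_mul_cos_pi_div (by norm_num) hn
    rw [Nat.cast_ofNat, Real.cos_pi_div_three] at this
    linarith
  have hy1 := h1 s h.three_le_s
  have hz1 := h1 r h.three_le_r
  have hyz := h.edge.cos_sq_add_cos_sq_lt
  generalize 2 * Real.cos (Real.pi / k) = x at *
  generalize 2 * Real.cos (Real.pi / s) = y at *
  generalize 2 * Real.cos (Real.pi / r) = z at *
  -- Here z ≥ 1 gives y² < 3; then q ≤ 196 + 28 · 1.7321 < 244.5.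
  have hy : y ≤ 1.7321 := by nlinarith
  have hxy : x * y ≤ 2 * 1.7321 := by gcongr
  have hxy0 : 0 ≤ x * y := mul_nonneg hx0 (by linarith)
  rw [mul_assoc]
  have h5 : u * (x * y) ≤ 14 * (2 * 1.7321) := by gcongr
  have h6 : 0 ≤ u * (x * y) := mul_nonneg (by linarith) hxy0
  refine ⟨by nlinarith, by nlinarith, sq_nonneg _, by nlinarith⟩

theorem gammaT_pos (h : 3 ≤ k) : 0 < (gammaT k s r u : ℝ) := by
  have := le_two_mul_cos_pi_div (by norm_num) h
  rw [Nat.cast_ofNat, Real.cos_pi_div_three] at this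
  rw [coe_gammaT]
  exact pow_pos (by linarith) 2

theorem gammaT_two : gammaT 2 s r u = 0 := by
  apply Subtype.ext
  rw [coe_gammaT]
  simp

theorem IsGamma44.gammaQ_two_le (h : IsGamma44 14 2 s r u) : (gammaQ 2 s r u : ℝ) ≤ 196 := by
  have hu := h.two_lt_u
  have hu' : u < 14 := h.minimality 0 1
  rw [coe_gammaQ, Nat.cast_ofNat, Real.cos_pi_div_two]
  nlinarith

theorem golden_of_eq_five {x : entryField (gramGamma44 k s r u)}
    (hx : (x : ℝ) = 2 * Real.cos (Real.pi / (5 : ℕ))) :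
    ((3 - x ^ 2 : entryField (gramGamma44 k s r u)) : ℝ) ^ 2 -
      3 * ((3 - x ^ 2 : entryField (gramGamma44 k s r u)) : ℝ) + 1 = 0 ∧
    ((3 - x ^ 2 : entryField (gramGamma44 k s r u)) : ℝ) ≤ 1 := by
  have h3 : ((3 - x ^ 2 : entryField (gramGamma44 k s r u)) : ℝ) = 3 - (x : ℝ) ^ 2 := rfl
  rw [h3, hx]
  refine ⟨golden_two_mul_cos_pi_div_five, ?_⟩
  have h4 := le_two_mul_cos_pi_div (m := 4) (n := 5) (by norm_num) (by norm_num)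
  have h5 := two_mul_cos_pi_div_four_sq
  have h6 : 0 ≤ 2 * Real.cos (Real.pi / (4 : ℕ)) := by
    rw [Nat.cast_ofNat, Real.cos_pi_div_four]; positivity
  nlinarith

theorem conj_golden {L : IntermediateField ℚ ℝ} (σ : L →+* ℝ) {e : L}
    (he : (e : ℝ) ^ 2 - 3 * e + 1 = 0) : 0 < σ e := by
  have hσe : σ e ^ 2 - 3 * σ e + 1 = 0 := by
    have : e ^ 2 - 3 * e + 1 = 0 := Subtype.ext (by push_cast; exact he)
    simpa only [map_add, map_sub, map_mul, map_pow, map_one, map_zero, map_ofNat]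
      using congrArg σ this
  nlinarith

theorem gammaT_mem (h : IsVArithmetic (gramGamma44 k s r u)) :
    (gammaT k s r u : ℝ) ∈ groundField (gramGamma44 k s r u) :=
  sq_mem_groundField h 0 2

theorem isIntegral_gammaT (h : IsVArithmetic (gramGamma44 k s r u)) :
    IsIntegral ℤ (gammaT k s r u : ℝ) :=
  isIntegral_sq h 0 2

theorem IsGamma44.finrank_le_of_three_three (h : IsGamma44 14 k 3 3 u) :
    Module.finrank ℚ (groundField (gramGamma44 k 3 3 u)) ≤ 20 ∧
    (k = 2 → Module.finrank ℚ (groundField (gramGamma44 k 3 3 u)) ≤ 16) := by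
  have hA := h.vArithmetic
  have := hA.numberField_entryField
  have := hA.numberField_groundField
  have := hA.totallyReal
  obtain ⟨hq0, hq1, ht0, ht4⟩ := h.gamma_bounds
  have hconj := fun σ hσ => conj_gamma_bounds hA σ hσ
    (map_sq_of_coe_eq_three σ rfl) (map_sq_of_coe_eq_three σ rfl) (by norm_num)
  have h16 : k = 2 → Module.finrank ℚ (groundField (gramGamma44 k 3 3 u)) ≤ 16 := by
    rintro rfl
    refine finrank_le_sixteen_of_interval (groundField_le_entryField _) gammaQ_mem
      (isIntegral_gammaQ hA) (by linarith) h.gammaQ_two_le fun σ hσ => ?_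
    obtain ⟨-, -, h1, h2⟩ := hconj σ hσ
    rw [gammaT_two, map_zero] at h1 h2
    constructor <;> linarith
  refine ⟨?_, h16⟩
  -- The triangle polynomial has the factor t, which vanishes for k = 2, so that case relies on the
  -- interval bound.
  rcases h.two_le_k.eq_or_lt with hk | hk
  · exact (h16 hk.symm).trans (by norm_num)
  have ht := gammaT_pos (s := 3) (r := 3) (u := u) hk
  refine finrank_le_twenty_of_triangle (p := gammaQ k 3 3 u) (t := gammaT k 3 3 u)
    (groundField_le_entryField _) gammaQ_mem (gammaT_mem hA) (isIntegral_gammaQ hA)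
    (isIntegral_gammaT hA) (abs_le.2 ⟨by linarith, by linarith⟩) ht ht4.le
    (by linarith : (0 : ℝ) < _).ne' ?_ ?_ fun σ hσ => ?_
  · exact (show (0 : ℝ) < gammaQ k 3 3 u + gammaT k 3 3 u - 2 by linarith).ne'
  · exact (show (0 : ℝ) < 2 * gammaQ k 3 3 u + gammaT k 3 3 u - 2 by linarith).ne'
  · obtain ⟨h0, h4, h1, h2⟩ := hconj σ hσ
    exact ⟨h0, h4, by linarith, by linarith⟩

/-- The triangle (0, 0), (0, 1), (4, −1) lies inside that of (3, 3), so the same polynomial serves.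
-/
theorem IsGamma44.finrank_le_of_three_four (h : IsGamma44 14 k 3 4 u) :
    Module.finrank ℚ (groundField (gramGamma44 k 3 4 u)) ≤ 20 ∧
    (k = 2 → Module.finrank ℚ (groundField (gramGamma44 k 3 4 u)) ≤ 8) := by
  have hA := h.vArithmetic
  have := hA.numberField_entryField
  have := hA.numberField_groundField
  have := hA.totallyReal
  obtain ⟨hq0, hq1, ht0, ht4⟩ := h.gamma_bounds
  have hconj := fun σ hσ => conj_gamma_bounds hA σ hσ
    (map_sq_of_coe_eq_three σ rfl) (map_sq_of_coe_eq_four σ rfl) (by norm_num)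
  have h8 : k = 2 → Module.finrank ℚ (groundField (gramGamma44 k 3 4 u)) ≤ 8 := by
    rintro rfl
    refine finrank_le_eight_of_interval (groundField_le_entryField _) gammaQ_mem
      (isIntegral_gammaQ hA) (by linarith) h.gammaQ_two_le fun σ hσ => ?_
    obtain ⟨-, -, h1, h2⟩ := hconj σ hσ
    rw [gammaT_two, map_zero] at h1 h2
    constructor <;> linarith
  refine ⟨?_, h8⟩
  rcases h.two_le_k.eq_or_lt with hk | hk
  · exact (h8 hk.symm).trans (by norm_num)
  have ht := gammaT_pos (s := 3) (r := 4) (u := u) hk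
  refine finrank_le_twenty_of_triangle (p := gammaQ k 3 4 u) (t := gammaT k 3 4 u)
    (groundField_le_entryField _) gammaQ_mem (gammaT_mem hA) (isIntegral_gammaQ hA)
    (isIntegral_gammaT hA) (abs_le.2 ⟨by linarith, by linarith⟩) ht ht4.le
    (by linarith : (0 : ℝ) < _).ne' ?_ ?_ fun σ hσ => ?_
  · exact (show (0 : ℝ) < gammaQ k 3 4 u + gammaT k 3 4 u - 2 by linarith).ne'
  · exact (show (0 : ℝ) < 2 * gammaQ k 3 4 u + gammaT k 3 4 u - 2 by linarith).ne'
  · obtain ⟨h0, h4, h1, h2⟩ := hconj σ hσ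
    exact ⟨h0, h4, by linarith, by linarith⟩

theorem IsGamma44.finrank_le_of_four_three (h : IsGamma44 14 k 4 3 u) :
    Module.finrank ℚ (groundField (gramGamma44 k 4 3 u)) ≤ 20 ∧
    (k = 2 → Module.finrank ℚ (groundField (gramGamma44 k 4 3 u)) ≤ 8) := by
  have hA := h.vArithmetic
  have := hA.numberField_entryField
  have := hA.numberField_groundField
  have := hA.totallyReal
  obtain ⟨hq0, hq1, ht0, ht4⟩ := h.gamma_bounds
  have hconj := fun σ hσ => conj_gamma_bounds hA σ hσ
    (map_sq_of_coe_eq_four σ rfl) (map_sq_of_coe_eq_three σ rfl) (by norm_num)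
  have h8 : k = 2 → Module.finrank ℚ (groundField (gramGamma44 k 4 3 u)) ≤ 8 := by
    rintro rfl
    refine finrank_le_eight_of_interval (groundField_le_entryField _) gammaQ_mem
      (isIntegral_gammaQ hA) (by linarith) h.gammaQ_two_le fun σ hσ => ?_
    obtain ⟨-, -, h1, h2⟩ := hconj σ hσ
    rw [gammaT_two, map_zero] at h1 h2
    constructor <;> linarith
  refine ⟨?_, h8⟩
  rcases h.two_le_k.eq_or_lt with hk | hk
  · exact (h8 hk.symm).trans (by norm_num)
  have ht := gammaT_pos (s := 4) (r := 3) (u := u) hk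
  have hp : ((1 - gammaQ k 4 3 u - gammaT k 4 3 u : entryField (gramGamma44 k 4 3 u)) : ℝ) =
    1 - gammaQ k 4 3 u - gammaT k 4 3 u := rfl
  -- The map q ↦ 1 − q − t carries the triangle (0, 0), (0, 1), (4, −2) onto (0, 1), (0, 0), (4,
  -- −1), inside that of (3, 3).
  refine finrank_le_twenty_of_triangle (p := 1 - gammaQ k 4 3 u - gammaT k 4 3 u)
    (t := gammaT k 4 3 u) (groundField_le_entryField _)
    (sub_mem (sub_mem (one_mem _) gammaQ_mem) (gammaT_mem hA)) (gammaT_mem hA)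
    ((isIntegral_one.sub (isIntegral_gammaQ hA)).sub (isIntegral_gammaT hA))
    (isIntegral_gammaT hA) ?_ ht ht4.le ?_ ?_ ?_ fun σ hσ => ?_
  · rw [hp]
    exact abs_le.2 ⟨by linarith, by linarith⟩
  · rw [hp]
    exact (by linarith : _ < (0 : ℝ)).ne
  · rw [hp]
    exact (by linarith : _ < (0 : ℝ)).ne
  · rw [hp]
    exact (by linarith : _ < (0 : ℝ)).ne
  · obtain ⟨h0, h4, h1, h2⟩ := hconj σ hσ
    simp only [map_sub, map_one]
    exact ⟨h0, h4, by linarith, by linarith⟩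

theorem IsGamma44.finrank_le_of_three_five (h : IsGamma44 14 k 3 5 u) :
    Module.finrank ℚ (groundField (gramGamma44 k 3 5 u)) ≤ 20 ∧
    (k = 2 → Module.finrank ℚ (groundField (gramGamma44 k 3 5 u)) ≤ 10) := by
  have hA := h.vArithmetic
  have := hA.numberField_entryField
  have := hA.numberField_groundField
  have := hA.totallyReal
  obtain ⟨hq0, hq1, ht0, ht4⟩ := h.gamma_bounds
  let e : entryField (gramGamma44 k 3 5 u) := 3 - entry _ 1 3 ^ 2
  obtain ⟨hee, he1⟩ : (e : ℝ) ^ 2 - 3 * e + 1 = 0 ∧ (e : ℝ) ≤ 1 := golden_of_eq_five rfl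
  have he0 : 0 < (e : ℝ) := by nlinarith
  have heK : (e : ℝ) ∈ groundField (gramGamma44 k 3 5 u) :=
    sub_mem (ofNat_mem _ 3) (sq_mem_groundField hA 1 3)
  have hei : IsIntegral ℤ (e : ℝ) :=
    (isIntegral_algebraMap (R := ℤ) (x := (3 : ℤ))).sub (isIntegral_sq hA 1 3)
  -- With Y = 1 and Z = 3 − σ e the quantity 4 − Y − Z is σ e, positive because both roots of X² −
  -- 3X + 1 are.
  have hconj := fun σ hσ => conj_gamma_bounds hA σ hσ (Z := 3 - σ e)
    (map_sq_of_coe_eq_three σ rfl) (by simp only [e, map_sub, map_pow, map_ofNat]; ring)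
    (by linarith [conj_golden σ hee])
  refine ⟨?_, ?_⟩
  · refine finrank_le_twenty_of_golden_triangle (p := gammaQ k 3 5 u) (t := gammaT k 3 5 u)
      (e := e) (groundField_le_entryField _) gammaQ_mem (gammaT_mem hA) heK
      (isIntegral_gammaQ hA) (isIntegral_gammaT hA) hei (abs_le.2 ⟨by linarith, by linarith⟩)
      ht0 ht4.le hee he1 ?_ ?_ ?_ ?_ fun σ hσ => ?_
    · exact (by linarith : (0 : ℝ) < _).ne'
    · exact (by linarith : (0 : ℝ) < _).ne'
    · exact (by linarith : (0 : ℝ) < _).ne'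
    · exact (by nlinarith : (0 : ℝ) < _).ne'
    · obtain ⟨h0, h4, h1, h2⟩ := hconj σ hσ
      exact ⟨h0, h4, by linarith, by linarith⟩
  · rintro rfl
    refine finrank_le_ten_of_golden_interval (groundField_le_entryField _) gammaQ_mem heK
      (isIntegral_gammaQ hA) hei hee he1 (by linarith) h.gammaQ_two_le fun σ hσ => ?_
    obtain ⟨-, -, h1, h2⟩ := hconj σ hσ
    rw [gammaT_two, map_zero] at h1 h2
    constructor <;> linarith

theorem IsGamma44.finrank_le_of_five_three (h : IsGamma44 14 k 5 3 u) :
    Module.finrank ℚ (groundField (gramGamma44 k 5 3 u)) ≤ 20 ∧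
    (k = 2 → Module.finrank ℚ (groundField (gramGamma44 k 5 3 u)) ≤ 10) := by
  have hA := h.vArithmetic
  have := hA.numberField_entryField
  have := hA.numberField_groundField
  have := hA.totallyReal
  obtain ⟨hq0, hq1, ht0, ht4⟩ := h.gamma_bounds
  let e : entryField (gramGamma44 k 5 3 u) := 3 - entry _ 1 2 ^ 2
  obtain ⟨hee, he1⟩ : (e : ℝ) ^ 2 - 3 * e + 1 = 0 ∧ (e : ℝ) ≤ 1 := golden_of_eq_five rfl
  have he0 : 0 < (e : ℝ) := by nlinarith
  have heK : (e : ℝ) ∈ groundField (gramGamma44 k 5 3 u) :=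
    sub_mem (ofNat_mem _ 3) (sq_mem_groundField hA 1 2)
  have hei : IsIntegral ℤ (e : ℝ) :=
    (isIntegral_algebraMap (R := ℤ) (x := (3 : ℤ))).sub (isIntegral_sq hA 1 2)
  have hconj := fun σ hσ => conj_gamma_bounds hA σ hσ (Y := 3 - σ e)
    (by simp only [e, map_sub, map_pow, map_ofNat]; ring) (map_sq_of_coe_eq_three σ rfl)
    (by linarith [conj_golden σ hee])
  refine ⟨?_, ?_⟩
  · have hp : ((e - gammaQ k 5 3 u - gammaT k 5 3 u : entryField (gramGamma44 k 5 3 u)) : ℝ) =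
      e - gammaQ k 5 3 u - gammaT k 5 3 u := rfl
    -- The map q ↦ e − q − t carries (0, 0), (0, e), (4, e − 3) to (0, e), (0, 0), (4, −1), the
    -- triangle of (3, 5).
    refine finrank_le_twenty_of_golden_triangle (p := e - gammaQ k 5 3 u - gammaT k 5 3 u)
      (t := gammaT k 5 3 u) (e := e) (groundField_le_entryField _)
      (sub_mem (sub_mem heK gammaQ_mem) (gammaT_mem hA)) (gammaT_mem hA) heK
      ((hei.sub (isIntegral_gammaQ hA)).sub (isIntegral_gammaT hA)) (isIntegral_gammaT hA) hei ?_
      ht0 ht4.le hee he1 ?_ ?_ ?_ ?_ fun σ hσ => ?_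
    · rw [hp]
      exact abs_le.2 ⟨by linarith, by linarith⟩
    · rw [hp]
      exact (by linarith : _ < (0 : ℝ)).ne
    · rw [hp]
      exact (by linarith : _ < (0 : ℝ)).ne
    · rw [hp]
      exact (by linarith : _ < (0 : ℝ)).ne
    · rw [hp]
      exact (by nlinarith : _ < (0 : ℝ)).ne
    · obtain ⟨h0, h4, h1, h2⟩ := hconj σ hσ
      simp only [map_sub]
      exact ⟨h0, h4, by linarith, by linarith⟩
  · rintro rfl
    refine finrank_le_ten_of_golden_interval (groundField_le_entryField _) gammaQ_mem heK
      (isIntegral_gammaQ hA) hei hee he1 (by linarith) h.gammaQ_two_le fun σ hσ => ?_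
    obtain ⟨-, -, h1, h2⟩ := hconj σ hσ
    rw [gammaT_two, map_zero] at h1 h2
    constructor <;> linarith

theorem IsGamma44.finrank_groundField_le (h : IsGamma44 14 k s r u) :
    Module.finrank ℚ (groundField (gramGamma44 k s r u)) ≤ 20 := by
  rcases h.edge.parameters h.three_le_s h.three_le_r with
    ⟨rfl, rfl⟩ | ⟨rfl, rfl⟩ | ⟨rfl, rfl⟩ | ⟨rfl, rfl⟩ | ⟨rfl, rfl⟩
  · exact h.finrank_le_of_three_three.1
  · exact h.finrank_le_of_three_four.1
  · exact h.finrank_le_of_four_three.1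
  · exact h.finrank_le_of_three_five.1
  · exact h.finrank_le_of_five_three.1

end gamma

end VArith

theorem mainTheorem10 :
    (∀ (k s r : ℕ) (u : ℝ), VArith.IsGamma44 14 k s r u →
      ∀ K : IntermediateField ℚ ℝ, K = VArith.groundField (VArith.gramGamma44 k s r u) →
        NumberField K ∧
        (k = 2 → s = 3 ∧ r = 3 → Module.finrank ℚ K ≤ 16) ∧
        (k = 2 → (s = 3 ∧ r = 4) ∨ (s = 4 ∧ r = 3) → Module.finrank ℚ K ≤ 8) ∧
        (k = 2 → (s = 3 ∧ r = 5) ∨ (s = 5 ∧ r = 3) → Module.finrank ℚ K ≤ 10) ∧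
        (r = 3 → k = 3 → Module.finrank ℚ K ≤ 25) ∧
        (r = 3 → k = 7 → Module.finrank ℚ K ≤ 21) ∧
        (¬ (r = 3 ∧ (k = 3 ∨ k = 7)) → Module.finrank ℚ K ≤ 20)) ∧
    (∀ K ∈ VArith.FGamma44 14, NumberField K ∧ Module.finrank ℚ K ≤ 25) := by
  refine ⟨?_, ?_⟩
  · rintro k s r u h K rfl
    have h20 := h.finrank_groundField_le
    refine ⟨h.vArithmetic.numberField_groundField, ?_, ?_, ?_, fun _ _ => h20.trans (by norm_num),
      fun _ _ => h20.trans (by norm_num), fun _ => h20⟩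
    · rintro hk ⟨rfl, rfl⟩
      exact h.finrank_le_of_three_three.2 hk
    · rintro hk (⟨rfl, rfl⟩ | ⟨rfl, rfl⟩)
      · exact h.finrank_le_of_three_four.2 hk
      · exact h.finrank_le_of_four_three.2 hk
    · rintro hk (⟨rfl, rfl⟩ | ⟨rfl, rfl⟩)
      · exact h.finrank_le_of_three_five.2 hk
      · exact h.finrank_le_of_five_three.2 hk
  · rintro K ⟨k, s, r, u, h, rfl⟩
    exact ⟨h.vArithmetic.numberField_groundField,
      h.finrank_groundField_le.trans (by norm_num)⟩
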